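/- All graphs are simple, undirected and connected, but not necessarily finite or locally finite; $d=d_G$ is the graph distance, $B_r(v,G)=\{x : d_G(v,x)\le r\}$, and $G-\{u\}$ is the subgraph induced by $V\setminus\{u\}$ (vertices in different components of it are at infinite distance). Let $s,s'$ be non-negative integers. A graph $G=(V,E)$ is *$(s,s')$-dismantlable* if $V$ admits a well-order $\preceq$ such that for each vertex $v$ other than the least one there is a vertex $u\ne v$ with $u\preceq v$ and $$B_s(v,G-\{u\})\cap\{w\in V: w\preceq v\}\subseteq B_{s'}(u,G).$$ In the *$(s,s')$-cop and robber game* on $G$ the players, starting at given vertices, move alternately, the cop first. The cop moves along a path of length at most $s'$ and the robber moves along a path of length at most $s$ that does not traverse the vertex occupied by the cop (both may stay in place). The cop captures the robber if at some moment they are at the same vertex. $G$ is *$(s,s')$-cop-win* if, from any initial positions of the cop and the robber, the cop has a strategy that captures the robber after finitely many moves, however the robber moves. For $\delta\ge 0$, $G$ is *$\delta$-hyperbolic* if for any four vertices $u,v,x,y$ the two larger of the three sums $d(u,v)+d(x,y)$, $d(u,x)+d(v,y)$, $d(u,y)+d(v,x)$ differ by at most $2\delta$. **Corollary 3.6.**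 Let $s'<s$. Every $(s,s')$-dismantlable graph is $64s^2$-hyperbolic. In particular, every finite $(s,s')$-cop-win graph (robber speed $s$, cop speed $s'$) is $64s^2$-hyperbolic. -/

import Mathlib

namespace CopRobber

variable {V : Type*}

/-- The ball of radius `r` centred at `v` in the graph `G`. The extended distance is used since
the ball is also needed in graphs that may be disconnected, such as `G - {u}`. -/
def ball (G : SimpleGraph V) (v : V) (r : ℕ) : Set V :=
  {x | G.edist v x ≤ (r : ℕ∞)}

/-- The ball of radius `r` centred at `v` in the graph `G - {u}`, the subgraph of `G` induced by
`V \ {u}`, for `v ≠ u`; viewed as a set of vertices of `G`. -/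
def ballDelete (G : SimpleGraph V) (u v : V) (h : v ≠ u) (r : ℕ) : Set V :=
  Subtype.val '' ball (G.induce {x | x ≠ u}) ⟨v, h⟩ r

/-- `G` is `(s, s')`-dismantlable: the vertex set admits a well-order such that for each vertex `v`
other than the least one there is another vertex `u` preceding `v` such that
`B_s(v, G - {u}) ∩ X_v ⊆ B_{s'}(u, G)`, where `X_v = {w | w ≤ v}`. -/
def IsDismantlable (G : SimpleGraph V) (s s' : ℕ) : Prop :=
  ∃ _ : LinearOrder V, WellFoundedLT V ∧
    ∀ v : V, (∃ w, w < v) →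
      ∃ (u : V) (h : u < v), ballDelete G u v h.ne' s ∩ Set.Iic v ⊆ ball G u s'

/-- `G` is `δ`-hyperbolic: for any four vertices, the two larger of the three distance sums
differ by at most `2 * δ`, i.e. each of the sums exceeds the maximum of the other two by at most
`2 * δ`. By symmetry under permuting the vertices one inequality suffices. -/
def IsHyperbolic (G : SimpleGraph V) (δ : ℝ) : Prop :=
  ∀ u v x y : V,
    (G.dist u v + G.dist x y : ℝ) ≤
      max (G.dist u x + G.dist v y : ℝ) (G.dist u y + G.dist v x : ℝ) + 2 * δ

/-- A legal move of the cop of speed `s'` from `c` to `c'`: along a path of length at most `s'`. -/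
def CopMove (G : SimpleGraph V) (s' : ℕ) (c c' : V) : Prop :=
  ∃ p : G.Walk c c', p.IsPath ∧ p.length ≤ s'

/-- A legal move of the robber of speed `s` from `r` to `r'` while the cop is at `c`: along a path
of length at most `s` that does not traverse `c`. -/
def RobberMove (G : SimpleGraph V) (s : ℕ) (c r r' : V) : Prop :=
  ∃ p : G.Walk r r', p.IsPath ∧ p.length ≤ s ∧ c ∉ p.support

/-- A strategy of the cop of speed `s'`: a rule that gives a legal move of the cop from the current
positions `c` of the cop and `r` of the robber and the list `h` of all their previous positions. -/
structure CopStrategy (G : SimpleGraph V) (s' : ℕ) where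
  move : (h : List (V × V)) → (c r : V) → V
  legal : ∀ h c r, CopMove G s' c (move h c r)

/-- The sequences `c` and `r` record a play in which the cop follows the strategy `σ`. In round `n`
the cop moves first, from `c n` to `c (n + 1)`; if this does not capture the robber, the robber
makes a legal move from `r n` to `r (n + 1)`. (Positions after a capture are irrelevant.) -/
def IsPlay (G : SimpleGraph V) (s : ℕ) {s' : ℕ} (σ : CopStrategy G s') (c r : ℕ → V) : Prop :=
  ∀ n, c (n + 1) = σ.move ((List.range n).map fun i => (c i, r i)) (c n) (r n) ∧
    (c (n + 1) ≠ r n → RobberMove G s (c (n + 1)) (r n) (r (n + 1)))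

/-- The cop is at some moment at the same vertex as the robber. -/
def IsCapture (c r : ℕ → V) : Prop :=
  ∃ n, c n = r n ∨ c (n + 1) = r n

/-- `G` is `(s, s')`-cop-win (robber speed `s`, cop speed `s'`): from any initial positions, the
cop has a strategy that captures the robber after finitely many moves, however the robber moves. -/
def IsCopWin (G : SimpleGraph V) (s s' : ℕ) : Prop :=
  ∀ c₀ r₀ : V, ∃ σ : CopStrategy G s',
    ∀ c r : ℕ → V, c 0 = c₀ → r 0 = r₀ → IsPlay G s σ c r → IsCapture c r

end CopRobber

namespace CopRobber

open SimpleGraph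

/-! Domination shortens loops. Let `v` be the largest vertex of a closed walk of length at least `4s
- 1`, and let `u` dominate it. In each direction from `v`, since `s' < s`, the walk reaches within
`s` steps a vertex whose distance to `u` is less than the number of steps taken. The arc between
these two vertices thus has a detour through `u` that is shorter by at least 2 (`exists_shortcut`).

Charge a step from `x` to `y` the cost `λ ^ d(p, x) * (1/2 - (f y - f x))`, with `f` 1-Lipschitz and
`λ = 1 - 1/(6s²)`. Arc and detour have the same ends and the weight is almost constant on the short
loop they form, so the `f` terms almost cancel and the detour costs no more. By induction on length,
closed walks have nonnegative cost (`walkCost_nonneg`).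

In a geodesic triangle, take `f` to be the distance from `a` and `p` a point on the side `ab`. That
side has very negative cost; if the other sides were farther than `30s²` from `p`, they could not
compensate. So triangles are slim, which gives the four-point condition.

For finite cop-win graphs, some vertex is dominated, or the robber would evade forever. Deleting it
gives the robber no new evasion (`IsEvasion.of_diff_singleton`), so dismantling continues. -/

theorem mem_ball_iff {V : Type*} {G : SimpleGraph V} (hG : G.Connected) {v x : V} {r : ℕ} :
    x ∈ ball G v r ↔ G.dist v x ≤ r := by
  change G.edist v x ≤ r ↔ _
  rw [← (hG v x).coe_dist_eq_edist, Nat.cast_le]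

theorem robberMove_iff {V : Type*} {G : SimpleGraph V} {s : ℕ} {c r r' : V} :
    RobberMove G s c r r' ↔ ∃ p : G.Walk r r', p.length ≤ s ∧ c ∉ p.support := by
  classical
  constructor
  · rintro ⟨p, -, h⟩
    exact ⟨p, h⟩
  · rintro ⟨p, hp, hc⟩
    exact ⟨p.bypass, p.bypass_isPath, p.length_bypass_le_length.trans hp,
      fun h => hc (p.support_bypass_subset_support h)⟩

theorem copMove_iff {V : Type*} {G : SimpleGraph V} (hG : G.Connected) {s' : ℕ} {c c' : V} :
    CopMove G s' c c' ↔ G.dist c c' ≤ s' := by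
  constructor
  · rintro ⟨p, -, hp⟩
    exact (dist_le p).trans hp
  · intro h
    obtain ⟨p, hp, hl⟩ := hG.exists_path_of_dist c c'
    exact ⟨p, hp, hl ▸ h⟩

theorem exists_walk_of_induce {V : Type*} {G : SimpleGraph V} {S : Set V} {a b : S}
    (p : (G.induce S).Walk a b) :
    ∃ q : G.Walk a b, q.length = p.length ∧ ∀ x ∈ q.support, x ∈ S := by
  induction p with
  | nil => exact ⟨.nil, rfl, by simp⟩
  | cons h p ih =>
    obtain ⟨q, hq, hS⟩ := ih
    exact ⟨.cons (induce_adj.1 h) q, by simp [hq], by simpa using hS⟩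

theorem exists_induce_walk {V : Type*} {G : SimpleGraph V} {S : Set V} {a b : V}
    (p : G.Walk a b) (ha : a ∈ S) (hb : b ∈ S) (hp : ∀ x ∈ p.support, x ∈ S) :
    ∃ q : (G.induce S).Walk ⟨a, ha⟩ ⟨b, hb⟩, q.length = p.length := by
  induction p with
  | nil => exact ⟨.nil, rfl⟩
  | @cons a c b h p ih =>
    have hc : c ∈ S := hp _ (by simp)
    obtain ⟨q, hq⟩ := ih hc hb fun x hx => hp x (by simp [hx])
    exact ⟨.cons (induce_adj.2 h) q, by simp [hq]⟩

theorem mem_ballDelete_iff {V : Type*} {G : SimpleGraph V} {u v w : V} (h : v ≠ u) {s : ℕ} :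
    w ∈ ballDelete G u v h s ↔ RobberMove G s u v w := by
  rw [robberMove_iff]
  constructor
  · rintro ⟨⟨x, hx⟩, hxs, rfl⟩
    have hxs' : (G.induce {x | x ≠ u}).edist ⟨v, h⟩ ⟨x, hx⟩ ≤ (s : ℕ∞) := hxs
    obtain ⟨p, hp⟩ := exists_walk_of_edist_ne_top
      (ne_top_of_le_ne_top (ENat.natCast_ne_top s) hxs')
    obtain ⟨q, hq, hS⟩ := exists_walk_of_induce p
    refine ⟨q, ?_, fun hu => hS u hu rfl⟩
    rw [hq]
    exact_mod_cast hp ▸ hxs'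
  · rintro ⟨p, hp, hu⟩
    have hw : ∀ x ∈ p.support, x ∈ {x | x ≠ u} := fun x hx hxu => hu (hxu ▸ hx)
    obtain ⟨q, hq⟩ := exists_induce_walk p h (hw _ p.end_mem_support) hw
    refine ⟨⟨w, hw _ p.end_mem_support⟩, (edist_le q).trans ?_, rfl⟩
    rw [hq]
    exact_mod_cast hp

/-! ### Finite cop-win graphs are dismantlable. -/

/-- The set of positions `E`, with the robber to move, is one from which the robber evades forever
a cop, where both players must end all their moves in `X`. -/
def IsEvasion {V : Type*} (G : SimpleGraph V) (s s' : ℕ) (X : Set V) (E : V → V → Prop) : Prop :=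
  ∀ c r, E c r → c ∈ X ∧ r ∈ X ∧ c ≠ r ∧ ∃ r' ∈ X, RobberMove G s c r r' ∧
    ∀ c' ∈ X, G.dist c c' ≤ s' → E c' r'

/-- The vertex `u` dominates `v` within `X`. -/
def Dominates {V : Type*} (G : SimpleGraph V) (s s' : ℕ) (X : Set V) (u v : V) : Prop :=
  u ∈ X ∧ v ∈ X ∧ u ≠ v ∧ ∀ w ∈ X, RobberMove G s u v w → G.dist u w ≤ s'

theorem exists_dominates_of_not_isEvasion {V : Type*} {G : SimpleGraph V} {s s' : ℕ} {X : Set V}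
    (h : ¬ IsEvasion G s s' X fun c r => c ∈ X ∧ r ∈ X ∧ c ≠ r) :
    ∃ u v, Dominates G s s' X u v := by
  contrapose! h
  rintro c r ⟨hc, hr, hne⟩
  refine ⟨hc, hr, hne, ?_⟩
  have := h c r
  simp only [Dominates, not_and, not_forall] at this
  obtain ⟨w, hw, hm, hd⟩ := this hc hr hne
  exact ⟨w, hw, hm, fun c' hc' hcc' => ⟨hc', hw, fun he => hd (he ▸ hcc')⟩⟩

/-- Either a geodesic from `v` to `w` avoids `u` and is a robber move, or it passes through `u`,
which is then at least as close to `w` as `v` is. -/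
theorem Dominates.dist_le {V : Type*} {G : SimpleGraph V} (hG : G.Connected) {s s' : ℕ}
    (hs : s' < s) {X : Set V} {u v w : V} (h : Dominates G s s' X u v) (hw : w ∈ X)
    (hvw : G.dist v w ≤ s') : G.dist u w ≤ s' := by
  classical
  obtain ⟨p, hp⟩ := hG.exists_walk_length_eq_dist v w
  by_cases hu : u ∈ p.support
  · have h1 := SimpleGraph.dist_le (p.dropUntil u hu)
    have h2 := p.length_dropUntil_le_length hu
    omega
  · exact h.2.2.2 w hw (robberMove_iff.2 ⟨p, by omega, hu⟩)

/-- The robber plays against the cop's shadow, which stands at `u` whenever the cop is at `v`. The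
retraction preserves legal cop moves by `Dominates.dist_le`. -/
theorem IsEvasion.of_diff_singleton {V : Type*} {G : SimpleGraph V} (hG : G.Connected) {s s' : ℕ}
    (hs : s' < s) {X : Set V} {u v : V} (h : Dominates G s s' X u v) {E : V → V → Prop}
    (hE : IsEvasion G s s' (X \ {v}) E) :
    ∃ E', IsEvasion G s s' X E' ∧ ∀ c r, E c r → E' c r := by
  classical
  obtain ⟨hu, hv, huv, hdom⟩ := id h
  set π : V → V := fun c => if c = v then u else c with hπ
  have hπv : ∀ c, c ≠ v → π c = c := fun c hc => if_neg hc
  have hπX : ∀ c ∈ X, π c ∈ X \ {v} := by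
    intro c hc
    by_cases hcv : c = v
    · simp [hπ, hcv, hu, huv]
    · rw [hπv c hcv]
      exact ⟨hc, hcv⟩
  have hlip : ∀ c ∈ X, ∀ c' ∈ X, G.dist c c' ≤ s' → G.dist (π c) (π c') ≤ s' := by
    intro c hc c' hc' hd
    by_cases hcv : c = v <;> by_cases hcv' : c' = v
    · simp [hπ, hcv, hcv']
    · rw [hπv c' hcv', hcv, show π v = u from if_pos rfl]
      exact h.dist_le hG hs hc' (hcv ▸ hd)
    · rw [hπv c hcv, hcv', show π v = u from if_pos rfl, dist_comm]
      exact h.dist_le hG hs hc (by rw [dist_comm]; exact hcv' ▸ hd)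
    · rwa [hπv c hcv, hπv c' hcv']
  refine ⟨fun c r => c ∈ X ∧ E (π c) r, ?_, fun c r hcr => ?_⟩
  · rintro c r ⟨hc, hcr⟩
    obtain ⟨-, ⟨hrX, hrv⟩, hne, r', ⟨hr'X, hr'v⟩, hmove, hnext⟩ := hE _ _ hcr
    have hfar : ¬ G.dist (π c) r' ≤ s' := fun hd =>
      (hE _ _ (hnext r' ⟨hr'X, hr'v⟩ hd)).2.2.1 rfl
    refine ⟨hc, hrX, ?_, r', hr'X, ?_, fun c' hc' hd =>
      ⟨hc', hnext _ (hπX c' hc') (hlip c hc c' hc' hd)⟩⟩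
    · rintro rfl
      exact hne (hπv c hrv)
    · by_cases hcv : c = v
      · subst hcv
        have hπc : π c = u := if_pos rfl
        rw [hπc] at hmove hfar
        obtain ⟨p, hp, hup⟩ := robberMove_iff.1 hmove
        -- If the path met the cop at `v`, its remainder would be a robber move from `v` avoiding
        -- `u`; domination would then put `r'` within reach of the shadow.
        refine robberMove_iff.2 ⟨p, hp, fun hvp => hfar ?_⟩
        exact hdom r' hr'X (robberMove_iff.2 ⟨p.dropUntil c hvp,
          (p.length_dropUntil_le_length hvp).trans hp,
          fun hu' => hup (p.support_dropUntil_subset_support hvp hu')⟩)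
      · rwa [hπv c hcv] at hmove
  · have hc := (hE _ _ hcr).1
    exact ⟨hc.1, by rwa [hπv c hc.2]⟩

/-- The set `X` has a dismantling order, given by a rank function. -/
def IsDismantlableOn {V : Type*} (G : SimpleGraph V) (s s' : ℕ) (X : Set V) : Prop :=
  ∃ ρ : V → ℕ, Set.InjOn ρ X ∧ ∀ v ∈ X, (∃ w ∈ X, ρ w < ρ v) →
    ∃ u, ρ u < ρ v ∧ Dominates G s s' {w | w ∈ X ∧ ρ w ≤ ρ v} u v

/-- A dominated vertex is removed and placed on top of the order of the remaining ones; the absence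
of evasions passes to the smaller set. -/
theorem isDismantlableOn_of_forall_not_isEvasion {V : Type*} {G : SimpleGraph V}
    (hG : G.Connected) {s s' : ℕ} (hs : s' < s) (X : Finset V)
    (hX : ∀ E, IsEvasion G s s' (X : Set V) E → ∀ c r, ¬ E c r) :
    IsDismantlableOn G s s' (X : Set V) := by
  classical
  induction X using Finset.strongInduction with
  | H X ih =>
  by_cases hsub : (X : Set V).Subsingleton
  · refine ⟨fun _ => 0, fun a ha b hb _ => hsub ha hb, fun v _ ⟨w, _, hw⟩ => ?_⟩
    exact absurd hw (lt_irrefl _)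
  obtain ⟨a, ha, b, hb, hab⟩ := Set.not_subsingleton_iff.1 hsub
  obtain ⟨u, v, hdom⟩ := exists_dominates_of_not_isEvasion (G := G) (s := s) (s' := s')
    (X := (X : Set V)) fun hE => hX _ hE a b ⟨ha, hb, hab⟩
  have hvX : v ∈ X := hdom.2.1
  have hcoe : ((X.erase v : Finset V) : Set V) = (X : Set V) \ {v} := Finset.coe_erase v X
  obtain ⟨ρ, hinj, hρ⟩ := ih (X.erase v) (Finset.erase_ssubset hvX) (by
    intro E hE c r hcr
    rw [hcoe] at hE
    obtain ⟨E', hE', hEE'⟩ := hE.of_diff_singleton hG hs hdom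
    exact hX E' hE' c r (hEE' c r hcr))
  rw [hcoe] at hinj hρ
  have hlt : ∀ w ∈ X, ρ w < X.sup ρ + 1 := fun w hw => Nat.lt_succ_of_le (Finset.le_sup hw)
  have hself : Function.update ρ v (X.sup ρ + 1) v = X.sup ρ + 1 := Function.update_self ..
  have hother : ∀ w, w ≠ v → Function.update ρ v (X.sup ρ + 1) w = ρ w :=
    fun w hw => Function.update_of_ne hw ..
  refine ⟨Function.update ρ v (X.sup ρ + 1), ?_, ?_⟩
  · intro x hx y hy hxy
    by_cases hxv : x = v <;> by_cases hyv : y = v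
    · rw [hxv, hyv]
    · rw [hxv, hself, hother y hyv] at hxy
      exact absurd hxy (hlt y hy).ne'
    · rw [hyv, hself, hother x hxv] at hxy
      exact absurd hxy (hlt x hx).ne
    · rw [hother x hxv, hother y hyv] at hxy
      exact hinj ⟨hx, hxv⟩ ⟨hy, hyv⟩ hxy
  · rintro x hx ⟨w, hw, hwx⟩
    by_cases hxv : x = v
    · subst hxv
      refine ⟨u, ?_, ⟨hdom.1, ?_⟩, ⟨hx, le_rfl⟩, hdom.2.2.1, fun w hw => hdom.2.2.2 w hw.1⟩
      · rw [hself, hother u hdom.2.2.1]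
        exact hlt u hdom.1
      · rw [hself, hother u hdom.2.2.1]
        exact (hlt u hdom.1).le
    · have hwv : w ≠ v := by
        rintro rfl
        rw [hself, hother x hxv] at hwx
        exact lt_asymm hwx (hlt x hx)
      rw [hother w hwv, hother x hxv] at hwx
      obtain ⟨u', hu', hd⟩ := hρ x ⟨hx, hxv⟩ ⟨w, ⟨hw, hwv⟩, hwx⟩
      have hu'X := hd.1.1
      have hset : {w | w ∈ (X : Set V) ∧ Function.update ρ v (X.sup ρ + 1) w ≤
          Function.update ρ v (X.sup ρ + 1) x} = {w | w ∈ (X : Set V) \ {v} ∧ ρ w ≤ ρ x} := by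
        ext y
        by_cases hyv : y = v
        · subst hyv
          have := hlt x hx
          simp only [Set.mem_ofPred_eq, hself, hother x hxv, Set.mem_sdiff, Set.mem_singleton_iff,
            not_true_eq_false, and_false, false_and, iff_false, not_and, not_le]
          exact fun _ => this
        · simp [hother x hxv, hyv]
      refine ⟨u', ?_, by rwa [hset]⟩
      rwa [hother u' hu'X.2, hother x hxv]

theorem IsDismantlableOn.isDismantlable {V : Type*} {G : SimpleGraph V} (hG : G.Connected)
    {s s' : ℕ} (h : IsDismantlableOn G s s' Set.univ) : IsDismantlable G s s' := by
  obtain ⟨ρ, hinj, hρ⟩ := h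
  have hinj' : Function.Injective ρ := Set.injOn_univ.1 hinj
  let o : LinearOrder V := LinearOrder.lift' ρ hinj'
  refine ⟨o, ⟨InvImage.wf ρ wellFounded_lt⟩, fun v ⟨w, hw⟩ => ?_⟩
  obtain ⟨u, hu, hd⟩ := hρ v trivial ⟨w, trivial, hw⟩
  refine ⟨u, hu, fun x hx => ?_⟩
  exact (mem_ball_iff hG).2 (hd.2.2.2 x ⟨trivial, hx.2⟩ ((mem_ballDelete_iff _).1 hx.1))

/-- The history and the current positions after `n` rounds of the play in which the cop follows
the strategy `σ` and the robber follows the memoryless strategy `ev`. -/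
def playState {V : Type*} {G : SimpleGraph V} {s' : ℕ} (σ : CopStrategy G s') (ev : V → V → V)
    (c₀ r₀ : V) : ℕ → List (V × V) × V × V
  | 0 => ([], c₀, r₀)
  | n + 1 =>
    let t := playState σ ev c₀ r₀ n
    let c' := σ.move t.1 t.2.1 t.2.2
    (t.1 ++ [t.2], c', ev c' t.2.2)

theorem not_isEvasion_of_isCopWin {V : Type*} {G : SimpleGraph V} (hG : G.Connected) {s s' : ℕ}
    (h : IsCopWin G s s') {E : V → V → Prop} (hE : IsEvasion G s s' Set.univ E) (c₀ r : V) :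
    ¬ E c₀ r := by
  intro hcr
  have hstep : ∀ c r, ∃ r', E c r → RobberMove G s c r r' ∧ ∀ c', G.dist c c' ≤ s' → E c' r' := by
    intro c r
    by_cases hcr : E c r
    · obtain ⟨-, -, -, r', -, hm, hn⟩ := hE c r hcr
      exact ⟨r', fun _ => ⟨hm, fun c' => hn c' trivial⟩⟩
    · exact ⟨r, fun h => absurd h hcr⟩
  choose ev hev using hstep
  -- `E` has the robber to move, but the cop opens the game. Hence the robber starts where the
  -- evasion would have sent it.
  obtain ⟨σ, hσ⟩ := h c₀ (ev c₀ r)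
  set t := playState σ ev c₀ (ev c₀ r) with ht
  have hinv : ∀ n, ∀ c', G.dist (t n).2.1 c' ≤ s' → E c' (t n).2.2 := by
    intro n
    induction n with
    | zero => exact (hev c₀ r hcr).2
    | succ n ih => exact (hev _ _ (ih _ ((copMove_iff hG).1 (σ.legal _ _ _)))).2
  have hmoved : ∀ n, E (t (n + 1)).2.1 (t n).2.2 := fun n =>
    hinv n _ ((copMove_iff hG).1 (σ.legal _ _ _))
  have hhist : ∀ n, (t n).1 = (List.range n).map fun i => ((t i).2.1, (t i).2.2) := by
    intro n
    induction n with
    | zero => rfl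
    | succ n ih =>
      rw [List.range_succ, List.map_append, ← ih]
      rfl
  obtain ⟨n, hn⟩ := hσ (fun n => (t n).2.1) (fun n => (t n).2.2) rfl rfl fun n =>
    ⟨by rw [← hhist n]; rfl, fun _ => (hev _ _ (hmoved n)).1⟩
  rcases hn with hn | hn
  · exact (hE _ _ (hinv n _ (by rw [dist_self]; exact Nat.zero_le _))).2.2.1 hn
  · exact (hE _ _ (hmoved n)).2.2.1 hn

theorem IsCopWin.isDismantlable {V : Type*} [Finite V] {G : SimpleGraph V} (hG : G.Connected)
    {s s' : ℕ} (hs : s' < s) (h : IsCopWin G s s') : IsDismantlable G s s' := by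
  have := Fintype.ofFinite V
  refine IsDismantlableOn.isDismantlable hG ?_
  rw [← Finset.coe_univ]
  refine isDismantlableOn_of_forall_not_isEvasion hG hs _ fun E hE c r => ?_
  rw [Finset.coe_univ] at hE
  exact not_isEvasion_of_isCopWin hG h hE c r

/-! ### Weighted costs and shortcuts of closed walks. -/

/-- The total cost of the steps of a walk. -/
def walkCost {V : Type*} {G : SimpleGraph V} (κ : V → V → ℝ) {x y : V} (w : G.Walk x y) : ℝ :=
  (w.darts.map fun d => κ d.fst d.snd).sum

theorem walkCost_nil {V : Type*} {G : SimpleGraph V} (κ : V → V → ℝ) (x : V) :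
    walkCost κ (Walk.nil : G.Walk x x) = 0 := rfl

theorem walkCost_cons {V : Type*} {G : SimpleGraph V} (κ : V → V → ℝ) {x y z : V}
    (h : G.Adj x y) (w : G.Walk y z) : walkCost κ (Walk.cons h w) = κ x y + walkCost κ w := rfl

theorem walkCost_append {V : Type*} {G : SimpleGraph V} (κ : V → V → ℝ) {x y z : V}
    (p : G.Walk x y) (q : G.Walk y z) : walkCost κ (p.append q) = walkCost κ p + walkCost κ q := by
  simp [walkCost, Walk.darts_append]

theorem walkCost_eq_sum {V : Type*} {G : SimpleGraph V} (κ : V → V → ℝ) {x y : V}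
    (w : G.Walk x y) :
    walkCost κ w = ∑ i ∈ Finset.range w.length, κ (w.getVert i) (w.getVert (i + 1)) := by
  induction w with
  | nil => rfl
  | cons h w ih =>
    rw [walkCost_cons, ih, Walk.length_cons, Finset.sum_range_succ', add_comm]
    simp

theorem walkCost_rotate {V : Type*} [DecidableEq V] {G : SimpleGraph V} (κ : V → V → ℝ) {x y : V}
    (w : G.Walk x x) (h : y ∈ w.support) : walkCost κ (w.rotate y h) = walkCost κ w :=
  ((w.rotate_darts y h).perm.map _).sum_eq

/-- For a constant weight `c` the `f` terms telescope; each step contributes an error of at most `h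
* (1 + A)`. -/
theorem abs_walkCost_sub_le {V : Type*} {G : SimpleGraph V} {φ f : V → ℝ} {A c h : ℝ}
    (hA : 0 ≤ A) (hf : ∀ x y, G.Adj x y → |f y - f x| ≤ 1) {x y : V} (w : G.Walk x y)
    (hφ : ∀ z ∈ w.support, |φ z - c| ≤ h) :
    |walkCost (fun x y => φ x * (A - (f y - f x))) w - c * (A * w.length - (f y - f x))| ≤
      h * (1 + A) * w.length := by
  induction w with
  | nil => simp [walkCost_nil]
  | @cons x z y hxz w ih =>
    have h1 := ih fun z hz => hφ z (by simp [hz])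
    have h2 := hφ x (by simp)
    have h3 : |(A - (f z - f x))| ≤ 1 + A := by
      have := abs_le.1 (hf x z hxz)
      rw [abs_le]
      constructor <;> linarith
    have h4 : |(φ x - c) * (A - (f z - f x))| ≤ h * (1 + A) := by
      rw [abs_mul]
      exact mul_le_mul h2 h3 (abs_nonneg _) ((abs_nonneg _).trans h2)
    rw [walkCost_cons, Walk.length_cons]
    push_cast
    calc _ = |(φ x - c) * (A - (f z - f x)) + (walkCost (fun x y => φ x * (A - (f y - f x))) w -
          c * (A * w.length - (f y - f z)))| := by
          congr 1
          ring
      _ ≤ _ := abs_add_le _ _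
      _ ≤ _ := by linarith

theorem two_mul_dist_le_length {V : Type*} {G : SimpleGraph V} {z x y : V} (w : G.Walk z z)
    (hx : x ∈ w.support) (hy : y ∈ w.support) : 2 * G.dist x y ≤ w.length := by
  classical
  have hy' : y ∈ (w.rotate x hx).support := (w.mem_support_rotate_iff x hx).2 hy
  have h1 := congrArg Walk.length ((w.rotate x hx).take_spec hy')
  rw [Walk.length_append, Walk.length_rotate] at h1
  have h2 := dist_le ((w.rotate x hx).takeUntil y hy')
  have h3 := dist_le ((w.rotate x hx).dropUntil y hy')
  rw [dist_comm] at h3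
  omega

theorem exists_dist_add_one_le {V : Type*} [LinearOrder V] {G : SimpleGraph V}
    (hG : G.Connected) {s s' : ℕ} (hs : s' < s) {u v : V} (h : u < v)
    (hd : ballDelete G u v h.ne' s ∩ Set.Iic v ⊆ ball G u s') {y : V} (w : G.Walk v y)
    (hw : ∀ x ∈ w.support, x ≤ v) (hl : s ≤ w.length) :
    ∃ k ≤ s, G.dist u (w.getVert k) + 1 ≤ k := by
  by_cases hu : u ∈ (w.take s).support
  · obtain ⟨k, hk, hks⟩ := Walk.mem_support_iff_exists_getVert.1 hu
    rw [Walk.take_length] at hks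
    rw [Walk.take_getVert] at hk
    have hsk : s ⊓ k = k := by omega
    rw [hsk] at hk
    refine ⟨k, by omega, ?_⟩
    rw [hk, dist_self]
    by_contra h0
    have : k = 0 := by omega
    rw [this, Walk.getVert_zero] at hk
    exact h.ne' hk
  · refine ⟨s, le_rfl, ?_⟩
    have : w.getVert s ∈ ball G u s' := hd ⟨(mem_ballDelete_iff _).2 (robberMove_iff.2
      ⟨w.take s, by rw [Walk.take_length]; omega, hu⟩), hw _ (w.getVert_mem_support s)⟩
    have := (mem_ball_iff hG).1 this
    omega

theorem exists_shortcut {V : Type*} {G : SimpleGraph V} (hG : G.Connected) {s s' : ℕ}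
    (hs : s' < s) (hdis : IsDismantlable G s s') {x : V} (c : G.Walk x x) (hc : 0 < c.length) :
    ∃ (y z : V) (old new : G.Walk y z) (rest : G.Walk z y),
      (∀ κ, walkCost κ c = walkCost κ old + walkCost κ rest) ∧
      c.length = old.length + rest.length ∧
      new.length + 2 ≤ old.length ∧ old.length + new.length + 2 ≤ 4 * s := by
  classical
  have hc2 : 2 ≤ c.length := by
    cases c with
    | nil => simp at hc
    | cons h c =>
      cases c with
      | nil => exact absurd h G.irrefl
      | cons h c => simp
  by_cases hshort : c.length + 2 ≤ 4 * s
  -- A loop this short is contracted to a point.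
  · exact ⟨x, x, c, .nil, .nil, fun κ => by simp [walkCost_nil], by simp, by simpa, by simpa⟩
  obtain ⟨o, -, hdis⟩ := hdis
  obtain ⟨v, hv, hmax⟩ := c.support.toFinset.exists_max_image id ⟨x, by simp⟩
  simp only [List.mem_toFinset, id_eq] at hv hmax
  have hlt : ∃ w, w < v := by
    set d := c.rotate v hv with hd
    have hdl : 0 < d.length := by rw [Walk.length_rotate]; exact hc
    have hadj : G.Adj v (d.getVert 1) := by
      simpa using d.adj_getVert_succ hdl
    have hmem := (c.mem_support_rotate_iff v hv).1 (d.getVert_mem_support 1)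
    exact ⟨_, lt_of_le_of_ne (hmax _ hmem) hadj.ne'⟩
  obtain ⟨u, huv, hball⟩ := hdis v hlt
  set d := c.rotate v hv with hd
  have hdl : d.length = c.length := Walk.length_rotate ..
  have hdsup : ∀ y ∈ d.support, y ≤ v := fun y hy =>
    hmax y ((c.mem_support_rotate_iff v hv).1 hy)
  obtain ⟨k, hks, hk⟩ := exists_dist_add_one_le hG hs huv hball d hdsup (by omega)
  obtain ⟨k', hks', hk'⟩ := exists_dist_add_one_le hG hs huv hball d.reverse
    (fun y hy => hdsup y (by simpa using hy)) (by rw [Walk.length_reverse]; omega)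
  rw [Walk.getVert_reverse] at hk'
  have hrest : ((d.drop k).getVert (d.length - k' - k)) = d.getVert (d.length - k') := by
    rw [Walk.drop_getVert]
    congr 1
    omega
  obtain ⟨e, he⟩ : ∃ e : G.Walk (d.getVert k) v, e = d.drop k := ⟨_, rfl⟩
  have hel : e.length = d.length - k := by rw [he, Walk.drop_length]
  rw [← he] at hrest
  rw [← hrest] at hk'
  obtain ⟨n₁, hn₁⟩ := hG.exists_walk_length_eq_dist (e.getVert (d.length - k' - k)) u
  obtain ⟨n₂, hn₂⟩ := hG.exists_walk_length_eq_dist u (d.getVert k)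
  rw [dist_comm] at hn₁
  have hde : ∀ κ, walkCost κ c = walkCost κ (d.take k) + walkCost κ e := fun κ => by
    rw [← walkCost_append, he, Walk.append_take_drop_eq, walkCost_rotate]
  have hee : ∀ κ, walkCost κ e = walkCost κ (e.take (d.length - k' - k)) +
      walkCost κ (e.drop (d.length - k' - k)) := fun κ => by
    rw [← walkCost_append, Walk.append_take_drop_eq]
  refine ⟨_, _, (e.drop (d.length - k' - k)).append (d.take k), n₁.append n₂,
    e.take (d.length - k' - k), fun κ => ?_, ?_, ?_, ?_⟩
  · rw [walkCost_append, hde, hee]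
    ring
  all_goals
    simp only [Walk.length_append, Walk.drop_length, Walk.take_length, hel]
    omega

/-- The weight of a vertex decays exponentially with the distance to `p`, slowly enough that no
closed walk has negative cost. -/
theorem walkCost_nonneg {V : Type*} {G : SimpleGraph V} (hG : G.Connected) {s s' : ℕ}
    (hs : s' < s) (hdis : IsDismantlable G s s') {f : V → ℝ}
    (hf : ∀ x y, G.Adj x y → |f y - f x| ≤ 1) (p : V) {x : V} (c : G.Walk x x) :
    0 ≤ walkCost (fun x y => (1 - 1 / (6 * (s : ℝ) ^ 2)) ^ G.dist p x * (1 / 2 - (f y - f x))) c := by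
  classical
  obtain ⟨l, hl⟩ : ∃ l, l = c.length := ⟨_, rfl⟩
  induction l using Nat.strong_induction_on generalizing x with
  | _ l ih =>
  rcases Nat.eq_zero_or_pos l with h0 | hpos
  · cases c with
    | nil => exact le_rfl
    | cons h c => simp [h0] at hl
  obtain ⟨y, z, old, new, rest, hcost, hlen, hless, hsum⟩ :=
    exists_shortcut hG hs hdis c (hl ▸ hpos)
  have hrec := ih (new.append rest).length (by rw [Walk.length_append]; omega)
    (new.append rest) rfl
  rw [walkCost_append] at hrec
  rw [hcost]
  have hs1 : (1 : ℝ) ≤ s := by exact_mod_cast (by omega : 1 ≤ s)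
  set ε : ℝ := 1 / (6 * (s : ℝ) ^ 2) with hε
  have hε0 : 0 < ε := by positivity
  have hεs : ε * (6 * (s : ℝ) ^ 2) = 1 := by
    rw [hε]
    field_simp
  have hε1 : ε ≤ 1 := by nlinarith
  -- The loop has length at most `2n` with `n = 2s - 1`, so its vertices are within `n` of `q`. The
  -- weights lie between `M(1 - nε)` and `M`, and are compared with the midpoint.
  obtain ⟨q, hq, hmin⟩ := (old.append new.reverse).support.toFinset.exists_min_image
    (fun z => G.dist p z) ⟨y, by simp⟩
  simp only [List.mem_toFinset] at hq hmin
  set M := (1 - ε) ^ G.dist p q with hM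
  have hM0 : 0 ≤ M := pow_nonneg (by linarith) _
  set n : ℝ := 2 * s - 1 with hn
  have hφ : ∀ z ∈ (old.append new.reverse).support,
      |(1 - ε) ^ G.dist p z - M * (1 - n * ε / 2)| ≤ M * (n * ε / 2) := by
    intro z hz
    have h1 := hmin z hz
    have h2 := two_mul_dist_le_length _ hq hz
    rw [Walk.length_append, Walk.length_reverse] at h2
    have h3 := hG.dist_triangle (u := p) (v := q) (w := z)
    have h4 : (1 - ε) ^ G.dist p z ≤ M := pow_le_pow_of_le_one (by linarith) (by linarith) h1
    have h5 : M * (1 - ε) ^ (2 * s - 1) ≤ (1 - ε) ^ G.dist p z := by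
      rw [hM, ← pow_add]
      exact pow_le_pow_of_le_one (by linarith) (by linarith) (by omega)
    have h6 := one_add_mul_le_pow (a := -ε) (by linarith) (2 * s - 1)
    rw [← sub_eq_add_neg, Nat.cast_sub (by omega)] at h6
    push_cast at h6
    rw [← hn] at h6
    have h7 := mul_le_mul_of_nonneg_left h6 hM0
    rw [abs_le]
    constructor <;> linarith
  have hA : (0 : ℝ) ≤ 1 / 2 := by norm_num
  have hold := (abs_le.1 (abs_walkCost_sub_le hA hf old fun z hz => hφ z
    (by rw [Walk.mem_support_append_iff]; exact Or.inl hz))).1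
  have hnew := (abs_le.1 (abs_walkCost_sub_le hA hf new fun z hz => hφ z
    (by rw [Walk.mem_support_append_iff]; exact Or.inr (by simpa using hz)))).2
  have ha : (new.length : ℝ) + 2 ≤ old.length := by exact_mod_cast hless
  have hb : (old.length : ℝ) + new.length ≤ 2 * n := by
    have : (old.length : ℝ) + new.length + 2 ≤ 4 * s := by exact_mod_cast hsum
    linarith
  -- Total error against the gain from saving two steps. This fixes `ε`: it needs `n(3n + 1)/2 ≤
  -- 6s²`.
  have hkey : 3 * n * (n * ε / 2) ≤ 1 - n * ε / 2 := by
    rw [hn]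
    nlinarith
  have hn0 : 0 ≤ n := by linarith
  have h1 : M * (n * ε / 2) * (old.length + new.length) ≤ M * (n * ε / 2) * (2 * n) :=
    mul_le_mul_of_nonneg_left hb (by positivity)
  have h2 : M * (3 * n * (n * ε / 2)) ≤ M * (1 - n * ε / 2) := mul_le_mul_of_nonneg_left hkey hM0
  have h3 : M * (1 - n * ε / 2) * 2 ≤ M * (1 - n * ε / 2) * (old.length - new.length) :=
    mul_le_mul_of_nonneg_left (by linarith)
      ((mul_nonneg hM0 (by positivity : 0 ≤ 3 * n * (n * ε / 2))).trans h2)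
  linarith

/-! ### Costs of geodesics and slim triangles. -/

theorem sum_range_pow_le {l : ℝ} (h0 : 0 ≤ l) (h1 : l < 1) (m : ℕ) :
    ∑ j ∈ Finset.range m, l ^ j ≤ 1 / (1 - l) := by
  rw [le_div_iff₀ (by linarith), mul_comm, mul_neg_geom_sum]
  linarith [pow_nonneg h0 m]

theorem sum_range_pow_max_le {l : ℝ} (h0 : 0 ≤ l) (h1 : l < 1) (d m : ℕ) :
    ∑ j ∈ Finset.range m, l ^ max d (j - d) ≤ l ^ d * (2 * d + 1 / (1 - l)) := by
  calc ∑ j ∈ Finset.range m, l ^ max d (j - d)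
      ≤ ∑ j ∈ Finset.range (2 * d + m), l ^ max d (j - d) :=
        Finset.sum_le_sum_of_subset_of_nonneg (Finset.range_mono (by omega))
          fun _ _ _ => pow_nonneg h0 _
    _ = ∑ j ∈ Finset.range (2 * d), l ^ max d (j - d) +
          ∑ j ∈ Finset.range m, l ^ max d (2 * d + j - d) := Finset.sum_range_add _ _ _
    _ ≤ ∑ j ∈ Finset.range (2 * d), l ^ d + ∑ j ∈ Finset.range m, l ^ d * l ^ j := by
        refine add_le_add (Finset.sum_le_sum fun j _ => ?_) (Finset.sum_le_sum fun j _ => ?_)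
        · exact pow_le_pow_of_le_one h0 h1.le (le_max_left _ _)
        · rw [← pow_add]
          exact pow_le_pow_of_le_one h0 h1.le (by omega)
    _ ≤ _ := by
        rw [← Finset.mul_sum, Finset.sum_const, Finset.card_range, nsmul_eq_mul]
        have := mul_le_mul_of_nonneg_left (sum_range_pow_le h0 h1 m) (pow_nonneg h0 d)
        push_cast
        linarith

/-- The total weight of a geodesic that stays far from the base point of the weight; `g i` is the
distance of its `i`-th vertex. -/
theorem sum_range_pow_le_of_le_add {l : ℝ} (h0 : 0 ≤ l) (h1 : l < 1) {g : ℕ → ℕ} {L D : ℕ}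
    {B : ℝ} (hg : ∀ i j, i ≤ j → j ≤ L → j ≤ i + g i + g j) (hD : ∀ i ≤ L, D ≤ g i)
    (hB : ∀ d : ℕ, D ≤ d → l ^ d * (2 * d + 1 / (1 - l)) ≤ B) :
    ∑ i ∈ Finset.range L, l ^ g i ≤ 2 * B := by
  -- Around the nearest index `k`, the triangle inequality gives `g i ≥ max (g k) (|i - k| - g k)`.
  obtain ⟨k, hk, hmin⟩ := (Finset.range (L + 1)).exists_min_image g ⟨0, by simp⟩
  have hkL : k ≤ L := Nat.lt_succ_iff.1 (Finset.mem_range.1 hk)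
  replace hmin : ∀ i ≤ L, g k ≤ g i := fun i hi => hmin i (Finset.mem_range.2 (by omega))
  have hhalf := fun m => (sum_range_pow_max_le h0 h1 (g k) m).trans (hB _ (hD k hkL))
  calc ∑ i ∈ Finset.range L, l ^ g i
      = ∑ i ∈ Finset.range k, l ^ g i + ∑ i ∈ Finset.range (L - k), l ^ g (k + i) := by
        rw [← Finset.sum_range_add, Nat.add_sub_cancel' hkL]
    _ ≤ ∑ i ∈ Finset.range k, l ^ max (g k) (k - 1 - i - g k) +
          ∑ i ∈ Finset.range (L - k), l ^ max (g k) (i - g k) := by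
        refine add_le_add (Finset.sum_le_sum fun i hi => ?_) (Finset.sum_le_sum fun i hi => ?_) <;>
          rw [Finset.mem_range] at hi <;>
          refine pow_le_pow_of_le_one h0 h1.le (max_le (hmin _ (by omega)) ?_)
        · have := hg i k (by omega) (by omega)
          omega
        · have := hg k (k + i) (by omega) (by omega)
          omega
    _ ≤ B + B := by
        rw [Finset.sum_range_reflect (fun i => l ^ max (g k) (i - g k)) k]
        exact add_le_add (hhalf k) (hhalf (L - k))
    _ = 2 * B := by ring

theorem dist_getVert_of_length_eq_dist {V : Type*} {G : SimpleGraph V} (hG : G.Connected)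
    {x y : V} (w : G.Walk x y) (hw : w.length = G.dist x y) {i j : ℕ} (hij : i ≤ j)
    (hj : j ≤ w.length) : G.dist (w.getVert i) (w.getVert j) = j - i := by
  have h1 := dist_le (w.take i)
  have h2 := dist_le (w.drop j)
  have h3 := dist_le ((w.drop i).take (j - i))
  rw [Walk.take_length] at h1 h3
  rw [Walk.drop_getVert, Nat.add_sub_cancel' hij] at h3
  rw [Walk.drop_length] at h2
  have h4 := hG.dist_triangle (u := x) (v := w.getVert i) (w := y)
  have h5 := hG.dist_triangle (u := w.getVert i) (v := w.getVert j) (w := y)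
  omega

/-- With `S = 6s²`, the threshold is `d = 5S`. There the second factor is `11S`, while `e⁵ ≥ 143 =
11 * 13`. -/
theorem pow_mul_le_of_thirty_mul_sq_le {s d : ℕ} (hs : 0 < s) (hd : 30 * s ^ 2 ≤ d) :
    (1 - 1 / (6 * (s : ℝ) ^ 2)) ^ d * (2 * d + 6 * (s : ℝ) ^ 2) ≤ 6 * (s : ℝ) ^ 2 / 13 := by
  have hs1 : (0 : ℝ) < s := by exact_mod_cast hs
  have hs2 : (1 : ℝ) ≤ s := by exact_mod_cast hs
  set S : ℝ := 6 * (s : ℝ) ^ 2 with hS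
  have hS0 : 1 ≤ S := by nlinarith
  have hdS : 5 * S ≤ d := by
    have : (30 : ℝ) * s ^ 2 ≤ d := by exact_mod_cast hd
    linarith
  have h5 : 143 ≤ Real.exp 5 := by
    have h := Real.exp_one_gt_d9
    calc (143 : ℝ) ≤ 2.7182818283 ^ 5 := by norm_num
      _ ≤ Real.exp 1 ^ 5 := by gcongr
      _ = Real.exp 5 := by rw [← Real.exp_nat_mul]; norm_num
  have h6 : 143 * (d / S - 4) ≤ Real.exp (d / S) := by
    have h := Real.add_one_le_exp (d / S - 5)
    have h' : 0 ≤ d / S - 5 := by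
      rw [sub_nonneg, le_div_iff₀ (by linarith)]
      exact hdS
    calc 143 * (d / S - 4) ≤ Real.exp 5 * Real.exp (d / S - 5) := by
          apply mul_le_mul h5 (by linarith) (by linarith) (Real.exp_nonneg _)
      _ = _ := by rw [← Real.exp_add]; congr 1; ring
  have h7 : (1 - 1 / S) ^ d * Real.exp (d / S) ≤ 1 := by
    have h := Real.add_one_le_exp (-(1 / S))
    have h8 : 0 ≤ 1 - 1 / S := by
      rw [sub_nonneg, div_le_one (by linarith)]
      exact hS0
    calc (1 - 1 / S) ^ d * Real.exp (d / S) ≤ Real.exp (-(1 / S)) ^ d * Real.exp (d / S) := by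
          gcongr
          linarith
      _ = 1 := by
          rw [← Real.exp_nat_mul, ← Real.exp_add, Real.exp_eq_one_iff]
          ring
  have h8 : 0 ≤ (1 - 1 / S) ^ d := pow_nonneg (by
      rw [sub_nonneg, div_le_one (by linarith)]
      exact hS0) _
  have h9 : 2 * (d : ℝ) + S ≤ S / 13 * (143 * (d / S - 4)) := by
    have : S / 13 * (143 * (d / S - 4)) = 11 * d - 44 * S := by
      field_simp
      ring
    linarith
  calc (1 - 1 / S) ^ d * (2 * d + S) ≤ (1 - 1 / S) ^ d * (S / 13 * Real.exp (d / S)) := by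
        refine mul_le_mul_of_nonneg_left (h9.trans ?_) h8
        exact mul_le_mul_of_nonneg_left h6 (by positivity)
    _ = S / 13 * ((1 - 1 / S) ^ d * Real.exp (d / S)) := by ring
    _ ≤ S / 13 * 1 := mul_le_mul_of_nonneg_left h7 (by positivity)
    _ = S / 13 := mul_one _

theorem abs_dist_sub_dist_le_one {V : Type*} {G : SimpleGraph V} (hG : G.Connected) (a : V)
    {x y : V} (h : G.Adj x y) : |(G.dist a y : ℝ) - G.dist a x| ≤ 1 := by
  have h1 := hG.dist_triangle (u := a) (v := x) (w := y)
  have h2 := hG.dist_triangle (u := a) (v := y) (w := x)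
  rw [dist_eq_one_iff_adj.2 h] at h1
  rw [dist_eq_one_iff_adj.2 h.symm] at h2
  rw [abs_le]
  have h3 : (G.dist a y : ℝ) ≤ G.dist a x + 1 := by exact_mod_cast h1
  have h4 : (G.dist a x : ℝ) ≤ G.dist a y + 1 := by exact_mod_cast h2
  constructor <;> linarith

theorem walkCost_le_of_far {V : Type*} {G : SimpleGraph V} (hG : G.Connected) {l : ℝ}
    (h0 : 0 ≤ l) (h1 : l < 1) {f : V → ℝ} (hf : ∀ x y, G.Adj x y → |f y - f x| ≤ 1) {p x y : V}
    (w : G.Walk x y) (hw : w.length = G.dist x y) {D : ℕ} (hD : ∀ z ∈ w.support, D ≤ G.dist p z)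
    {B : ℝ} (hB : ∀ d : ℕ, D ≤ d → l ^ d * (2 * d + 1 / (1 - l)) ≤ B) :
    walkCost (fun x y => l ^ G.dist p x * (1 / 2 - (f y - f x))) w ≤ 3 * B := by
  have hsum := sum_range_pow_le_of_le_add h0 h1 (g := fun i => G.dist p (w.getVert i))
    (L := w.length) (D := D) (B := B) (fun i j hij hj => by
      have h := dist_getVert_of_length_eq_dist hG w hw hij hj
      have h' := hG.dist_triangle (u := w.getVert i) (v := p) (w := w.getVert j)
      rw [dist_comm (v := p)] at h'
      omega) (fun i _ => hD _ (w.getVert_mem_support i)) hB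
  rw [walkCost_eq_sum]
  calc _ ≤ ∑ i ∈ Finset.range w.length, 3 / 2 * l ^ G.dist p (w.getVert i) := by
        refine Finset.sum_le_sum fun i hi => ?_
        have := (abs_le.1 (hf _ _ (w.adj_getVert_succ (Finset.mem_range.1 hi)))).1
        rw [mul_comm]
        exact mul_le_mul_of_nonneg_right (by linarith) (pow_nonneg h0 _)
    _ ≤ 3 * B := by
        rw [← Finset.mul_sum]
        linarith

/-- Each step costs `-1/2` times its weight. A step is weighted at its start, so the exponents begin
at 1 before the base point and at 0 after it, whence the factor `1 + l`. -/
theorem walkCost_geodesic_le {V : Type*} {G : SimpleGraph V} (hG : G.Connected) {l : ℝ}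
    (h0 : 0 ≤ l) (h1 : l < 1) {a b : V} (w : G.Walk a b) (hw : w.length = G.dist a b) {i D : ℕ}
    (hi : D ≤ i) (hi' : i + D ≤ w.length) :
    walkCost (fun x y => l ^ G.dist (w.getVert i) x *
      (1 / 2 - ((G.dist a y : ℝ) - G.dist a x))) w ≤
      -(1 / 2 * ((1 + l) * (1 - l ^ D) / (1 - l))) := by
  have hgeom : ∀ m, D ≤ m → (1 - l ^ D) / (1 - l) ≤ ∑ j ∈ Finset.range m, l ^ j := by
    intro m hm
    rw [div_le_iff₀ (by linarith), mul_comm _ (1 - l), mul_neg_geom_sum]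
    linarith [pow_le_pow_of_le_one h0 h1.le hm]
  have hda : ∀ j ≤ w.length, G.dist a (w.getVert j) = j := fun j hj => by
    simpa using dist_getVert_of_length_eq_dist hG w hw (Nat.zero_le j) hj
  have hsum : (1 + l) * (1 - l ^ D) / (1 - l) ≤
      ∑ j ∈ Finset.range w.length, l ^ G.dist (w.getVert i) (w.getVert j) := by
    calc (1 + l) * (1 - l ^ D) / (1 - l)
        = l * ((1 - l ^ D) / (1 - l)) + (1 - l ^ D) / (1 - l) := by ring
      _ ≤ l * ∑ j ∈ Finset.range i, l ^ j + ∑ j ∈ Finset.range (w.length - i), l ^ j :=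
          add_le_add (mul_le_mul_of_nonneg_left (hgeom i hi) h0) (hgeom _ (by omega))
      _ = ∑ j ∈ Finset.range i, l ^ G.dist (w.getVert i) (w.getVert j) +
          ∑ j ∈ Finset.range (w.length - i), l ^ G.dist (w.getVert i) (w.getVert (i + j)) := by
          congr 1
          · rw [Finset.mul_sum, ← Finset.sum_range_reflect]
            refine Finset.sum_congr rfl fun j hj => ?_
            rw [Finset.mem_range] at hj
            rw [dist_comm, dist_getVert_of_length_eq_dist hG w hw hj.le (by omega), ← pow_succ']
            congr 1
            omega
          · refine Finset.sum_congr rfl fun j hj => ?_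
            rw [Finset.mem_range] at hj
            rw [dist_getVert_of_length_eq_dist hG w hw (by omega) (by omega)]
            congr 1
            omega
      _ = _ := by rw [← Finset.sum_range_add, Nat.add_sub_cancel' (by omega)]
  rw [walkCost_eq_sum]
  calc _ = ∑ j ∈ Finset.range w.length,
          -(1 / 2) * l ^ G.dist (w.getVert i) (w.getVert j) := by
        refine Finset.sum_congr rfl fun j hj => ?_
        rw [Finset.mem_range] at hj
        rw [hda j hj.le, hda (j + 1) hj]
        push_cast
        ring
    _ ≤ _ := by
        rw [← Finset.mul_sum]
        linarith

theorem exists_dist_le_of_geodesic_triangle {V : Type*} {G : SimpleGraph V} (hG : G.Connected)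
    {s s' : ℕ} (hs : s' < s) (hdis : IsDismantlable G s s') {a b c : V} (P : G.Walk a b)
    (Q : G.Walk b c) (R : G.Walk c a) (hP : P.length = G.dist a b) (hQ : Q.length = G.dist b c)
    (hR : R.length = G.dist c a) {i : ℕ} (hi : i ≤ P.length) :
    ∃ y, (y ∈ Q.support ∨ y ∈ R.support) ∧ G.dist (P.getVert i) y ≤ 30 * s ^ 2 := by
  by_contra! hfar
  have hs1 : (1 : ℝ) ≤ s := by exact_mod_cast (by omega : 1 ≤ s)
  set S : ℝ := 6 * (s : ℝ) ^ 2 with hS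
  have hS6 : 6 ≤ S := by nlinarith
  have hS0 : 0 < S := by linarith
  have hSinv : 1 / S ≤ 1 / 6 := one_div_le_one_div_of_le (by norm_num) hS6
  have hSpos : 0 < 1 / S := by positivity
  have hl : 1 / (1 - (1 - 1 / S)) = S := by simp
  have h0 : 0 ≤ 1 - 1 / S := by linarith
  have h1 : 1 - 1 / S < 1 := by linarith
  have hf : ∀ x y, G.Adj x y → |(G.dist a y : ℝ) - G.dist a x| ≤ 1 :=
    fun x y h => abs_dist_sub_dist_le_one hG a h
  have hB : ∀ d : ℕ, 30 * s ^ 2 ≤ d →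
      (1 - 1 / S) ^ d * (2 * d + 1 / (1 - (1 - 1 / S))) ≤ S / 13 := fun d hd => by
    rw [hl]
    exact pow_mul_le_of_thirty_mul_sq_le (by omega) hd
  have hcQ := walkCost_le_of_far hG h0 h1 hf Q hQ (fun z hz => (hfar z (Or.inl hz)).le) hB
  have hcR := walkCost_le_of_far hG h0 h1 hf R hR (fun z hz => (hfar z (Or.inr hz)).le) hB
  have hia : G.dist (P.getVert i) a = i := by
    have := dist_getVert_of_length_eq_dist hG P hP (Nat.zero_le i) hi
    rw [Walk.getVert_zero, dist_comm] at this
    exact this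
  have hib : G.dist (P.getVert i) b = P.length - i := by
    have := dist_getVert_of_length_eq_dist hG P hP hi le_rfl
    rwa [Walk.getVert_length] at this
  have hiD := (hfar a (Or.inr R.end_mem_support)).le
  have hiD' := (hfar b (Or.inl Q.start_mem_support)).le
  rw [hia] at hiD
  rw [hib] at hiD'
  have hcP := walkCost_geodesic_le hG h0 h1 P hP hiD (by omega)
  have hnonneg := walkCost_nonneg hG hs hdis hf (P.getVert i) (P.append (Q.append R))
  rw [← hS, walkCost_append, walkCost_append] at hnonneg
  have hpow := hB (30 * s ^ 2) le_rfl
  rw [hl] at hpow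
  set t := (1 - 1 / S) ^ (30 * s ^ 2) with ht
  have ht0 : 0 ≤ t := pow_nonneg h0 _
  have ht13 : t ≤ 1 / 13 := by
    have h2 : t * S ≤ t * (2 * ((30 * s ^ 2 : ℕ) : ℝ) + S) :=
      mul_le_mul_of_nonneg_left (by linarith [Nat.cast_nonneg (α := ℝ) (30 * s ^ 2)]) ht0
    have h3 : t * S ≤ 1 / 13 * S := by linarith
    exact le_of_mul_le_mul_right h3 hS0
  have hgain : (1 + (1 - 1 / S)) * (1 - t) / (1 - (1 - 1 / S)) ≥ 22 / 13 * S := by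
    rw [div_eq_mul_one_div, hl]
    refine mul_le_mul_of_nonneg_right ?_ hS0.le
    nlinarith
  -- The side `P` costs at most `-11S/13` and the other two at most `3S/13` each, so the closed walk
  -- would have negative cost.
  linarith

/-! ### From slim triangles to the four-point condition. -/

/-- On a geodesic from `u` to `v` there is a point close to geodesics from `x` to both `u`
and `v`. -/
theorem exists_getVert_dist_add_le {V : Type*} {G : SimpleGraph V} (hG : G.Connected)
    {D : ℕ} {u v x : V} (P : G.Walk u v) (Q : G.Walk v x) (R : G.Walk x u)
    (hQ : Q.length = G.dist v x) (hR : R.length = G.dist x u)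
    (hslim : ∀ i ≤ P.length, ∃ y, (y ∈ Q.support ∨ y ∈ R.support) ∧ G.dist (P.getVert i) y ≤ D) :
    ∃ i ≤ P.length, G.dist u (P.getVert i) + G.dist (P.getVert i) x ≤ G.dist u x + 2 * D ∧
      G.dist v (P.getVert i) + G.dist (P.getVert i) x ≤ G.dist v x + 2 * D + 2 := by
  classical
  have hnear : ∀ {y z : V} (W : G.Walk y z), W.length = G.dist y z → ∀ q ∈ W.support, ∀ m,
      G.dist m q ≤ D → G.dist y m + G.dist m z ≤ G.dist y z + 2 * D := by
    intro y z W hW q hq m hm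
    have h1 := dist_le (W.takeUntil q hq)
    have h2 := dist_le (W.dropUntil q hq)
    have h3 := congrArg Walk.length (W.take_spec hq)
    rw [Walk.length_append] at h3
    have h4 := hG.dist_triangle (u := y) (v := q) (w := m)
    have h5 := hG.dist_triangle (u := m) (v := q) (w := z)
    rw [dist_comm (u := q) (v := m)] at h4
    omega
  set C : ℕ → Prop := fun i =>
    G.dist u (P.getVert i) + G.dist (P.getVert i) x ≤ G.dist u x + 2 * D with hC
  have hor : ∀ i ≤ P.length, C i ∨
      G.dist v (P.getVert i) + G.dist (P.getVert i) x ≤ G.dist v x + 2 * D := by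
    intro i hi
    obtain ⟨y, hy | hy, hd⟩ := hslim i hi
    · exact Or.inr (hnear Q hQ y hy _ hd)
    · left
      have := hnear R hR y hy _ hd
      rw [dist_comm (u := x), dist_comm (v := u), dist_comm (u := x)] at this
      change _ ≤ _
      omega
  have hC0 : C 0 := by simp [hC]
  -- At the last index satisfying `C`, the next vertex must satisfy the other alternative; stepping
  -- back once costs the extra 2.
  set i := Nat.findGreatest C P.length with hi
  have hiL : i ≤ P.length := Nat.findGreatest_le _
  refine ⟨i, hiL, Nat.findGreatest_spec (Nat.zero_le _) hC0, ?_⟩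
  rcases hiL.eq_or_lt with heq | hlt
  · rw [heq, Walk.getVert_length, dist_self]
    omega
  · have hnot : ¬ C (i + 1) := Nat.findGreatest_is_greatest (Nat.lt_succ_self i) hlt
    have h1 := (hor (i + 1) hlt).resolve_left hnot
    have hadj := dist_eq_one_iff_adj.2 (P.adj_getVert_succ hlt)
    have h2 := hG.dist_triangle (u := v) (v := P.getVert (i + 1)) (w := P.getVert i)
    have h3 := hG.dist_triangle (u := P.getVert i) (v := P.getVert (i + 1)) (w := x)
    rw [dist_comm (u := P.getVert (i + 1)) (v := P.getVert i)] at h2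
    omega

/-- Points on `P` chosen for `x` and `y` give a route from `x` to `y`; their order along `P` decides
which of the two sums bounds the total. -/
theorem dist_add_dist_le_of_slim {V : Type*} {G : SimpleGraph V} (hG : G.Connected) {D : ℕ}
    (hslim : ∀ (a b c : V) (P : G.Walk a b) (Q : G.Walk b c) (R : G.Walk c a),
      P.length = G.dist a b → Q.length = G.dist b c → R.length = G.dist c a →
      ∀ i ≤ P.length, ∃ y, (y ∈ Q.support ∨ y ∈ R.support) ∧ G.dist (P.getVert i) y ≤ D)
    (u v x y : V) :
    G.dist u v + G.dist x y ≤
      max (G.dist u x + G.dist v y) (G.dist u y + G.dist v x) + (4 * D + 2) := by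
  obtain ⟨P, hP⟩ := hG.exists_walk_length_eq_dist u v
  have hexists : ∀ z, ∃ i ≤ P.length,
      G.dist u (P.getVert i) + G.dist (P.getVert i) z ≤ G.dist u z + 2 * D ∧
      G.dist v (P.getVert i) + G.dist (P.getVert i) z ≤ G.dist v z + 2 * D + 2 := by
    intro z
    obtain ⟨Q, hQ⟩ := hG.exists_walk_length_eq_dist v z
    obtain ⟨R, hR⟩ := hG.exists_walk_length_eq_dist z u
    exact exists_getVert_dist_add_le hG P Q R hQ hR (hslim u v z P Q R hP hQ hR)
  have hu : ∀ i ≤ P.length, G.dist u (P.getVert i) = i := fun i hi => by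
    simpa using dist_getVert_of_length_eq_dist hG P hP (Nat.zero_le i) hi
  have hv : ∀ i ≤ P.length, G.dist v (P.getVert i) = P.length - i := fun i hi => by
    simpa [dist_comm (u := v)] using dist_getVert_of_length_eq_dist hG P hP hi le_rfl
  obtain ⟨i, hi, hi1, hi2⟩ := hexists x
  obtain ⟨j, hj, hj1, hj2⟩ := hexists y
  rw [hu i hi] at hi1
  rw [hv i hi] at hi2
  rw [hu j hj] at hj1
  rw [hv j hj] at hj2
  have h1 := hG.dist_triangle (u := x) (v := P.getVert i) (w := y)
  have h2 := hG.dist_triangle (u := P.getVert i) (v := P.getVert j) (w := y)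
  rw [dist_comm (u := x) (v := P.getVert i)] at h1
  rcases le_total i j with hij | hij
  · have h3 := dist_getVert_of_length_eq_dist hG P hP hij hj
    have h4 := le_max_right (G.dist u x + G.dist v y) (G.dist u y + G.dist v x)
    omega
  · have h3 := dist_getVert_of_length_eq_dist hG P hP hij hi
    rw [dist_comm] at h3
    have h4 := le_max_left (G.dist u x + G.dist v y) (G.dist u y + G.dist v x)
    omega

theorem IsDismantlable.isHyperbolic {V : Type*} {G : SimpleGraph V} (hG : G.Connected)
    {s s' : ℕ} (hs : s' < s) (h : IsDismantlable G s s') : IsHyperbolic G (64 * (s : ℝ) ^ 2) := by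
  intro u v x y
  have h1 := dist_add_dist_le_of_slim hG (D := 30 * s ^ 2) (fun a b c P Q R hP hQ hR i hi =>
    exists_dist_le_of_geodesic_triangle hG hs h P Q R hP hQ hR hi) u v x y
  have h2 : (G.dist u v + G.dist x y : ℝ) ≤
      max (G.dist u x + G.dist v y : ℝ) (G.dist u y + G.dist v x : ℝ) +
        (4 * (30 * (s : ℝ) ^ 2) + 2) := by
    exact_mod_cast h1
  have hs1 : (1 : ℝ) ≤ s := by exact_mod_cast (by omega : 1 ≤ s)
  -- `4 * 30s² + 2 ≤ 2 * 64s²` because `s ≥ 1`.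
  nlinarith

end CopRobber

theorem corollary3p6 {V : Type*} (G : SimpleGraph V) (hG : G.Connected) (s s' : ℕ) (hs : s' < s) :
    (CopRobber.IsDismantlable G s s' → CopRobber.IsHyperbolic G (64 * (s : ℝ) ^ 2)) ∧
    (Finite V → CopRobber.IsCopWin G s s' → CopRobber.IsHyperbolic G (64 * (s : ℝ) ^ 2)) :=
  ⟨fun h => h.isHyperbolic hG hs, fun _ h => (h.isDismantlable hG hs).isHyperbolic hG hs⟩
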